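/- \textbf{Setting.} Let $\mathcal T$ be a locally compact metric space and let $\mathcal A$ be a nonempty collection of compact subsets of $\mathcal T$ such that: (a) $\emptyset' := \bigcap_{A\in\mathcal A}A$ is nonempty and $\mathcal A$ is closed under arbitrary (nonempty) intersections; (b) (Shape) if $A,A_1,\dots,A_k\in\mathcal A$ and $A\subseteq\bigcup_i A_i$, then $A\subseteq A_i$ for some $i$; (c) if $(A_n)$ is an increasing sequence in $\mathcal A$ and all $A_n\subseteq V$ for some $V\in\mathcal A$, then $\overline{\bigcup_n A_n}\in\mathcal A$; (d) if $U\subsetneq V$ are in $\mathcal A$, there is $W\in\mathcal A$ with $U\subsetneq W\subsetneq V$; (e) if $U,A_1,\dots,A_k\in\mathcal A$ and $U\subseteq(\bigcup_i A_i)^\circ$, then $U\subseteq A_i^\circ$ for some $i$. Let $m$ be a measure on $\mathcal T$, defined on a $\sigma$-algebra containing $\mathcal A$ and finite on the members of $\mathcal A$ (for instance a Radon measure on $\sigma(\mathcal A)$), with $m(\emptyset')=0$ and $m(A_n)\to m(\overline{\bigcup_k A_k})$ for every increasing sequence $(A_n)$ in $\mathcal A$ such that $\overline{\bigcup_kA_k}\in\mathcal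 A$. Let $\mathcal A(u)$ be the class of finite unions of members of $\mathcal A$. Let $X=\{X_U;\,U\in\mathcal A\}$ be a real-valued mean-zero Gaussian process on a probability space. It is a \emph{stationary set-indexed Ornstein--Uhlenbeck process} if there are $\lambda,\sigma>0$ with $$E[X_UX_V]=\frac{\sigma^2}{2\lambda}\,e^{-\lambda m(U\triangle V)}\qquad\text{for all }U,V\in\mathcal A.$$ \textbf{Theorem.} Assume that $X$ is non-degenerate: some $X_U$ is not a.s. zero and, unless $m$ vanishes on $\mathcal A$, there are $U,V\in\mathcal A$ such that $X_U=X_V$ a.s. fails. Then $X$ is a stationary set-indexed Ornstein--Uhlenbeck process if and only if the following three properties hold. (i) \emph{$L^2$-monotone inner- and outer-continuity:} $E|X_{U_n}-X_{\overline{\cup_kU_k}}|^2\to0$ for every increasing sequence $(U_n)$ in $\mathcal A$ with $\overline{\bigcup_kU_k}\in\mathcal A$, and $E|X_{V_n}-X_{\cap_kV_k}|^2\to0$ for every decreasing sequence $(V_n)$ in $\mathcal A$. (ii) \emph{$m$-stationarity:} for all $k\in\mathbb N$, $V\in\mathcal A$ and increasing $(U_i)_{i\le k}$, $(A_i)_{i\le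 k}$ in $\mathcal A$ with $V\subseteq U_i$ and $m(U_i\setminus V)=m(A_i)$ for all $i$, the vectors $(X_{U_1},\dots,X_{U_k})$ and $(X_{A_1},\dots,X_{A_k})$ have the same law. (iii) \emph{$\mathcal C$-Markov property:} let $A\in\mathcal A$, $B\in\mathcal A(u)$, $B\subseteq A$ with $C=A\setminus B\neq\emptyset$, and let $B=\bigcup_{i\le k}A_i$ be the extremal representation of $B$ ($A_i\in\mathcal A$, $A_i\not\subseteq A_j$ for $i\ne j$). Let $\mathcal A_C$ be the set of those intersections of one or more of the $A_i$ that are not contained in $B^\circ$, and $\boldsymbol X_C=(X_U)_{U\in\mathcal A_C}$. Let $\mathcal G^*_C=\bigvee_{B'\in\mathcal A(u),\,B'\cap C=\emptyset}\mathcal F_{B'}$, where $\mathcal F_{B'}=\bigvee_{A'\in\mathcal A,\,A'\subseteq B'}\mathcal F_{A'}$ and $\mathcal F_{A'}=\sigma(X_U:\,U\in\mathcal A,\,U\subseteq A')$. Then for every Borel $f:\mathbb R\to\mathbb R_+$ with $f(X_A)$ integrable, $$E[f(X_A)\mid\mathcal G^*_C]=E[f(X_A)\mid\boldsymbol X_C]\quad\text{a.s.}$$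 -/

import Mathlib

open MeasureTheory ProbabilityTheory Filter Topology Set

namespace SetIndexedOU

/-- An indexing collection: a nonempty class `𝒜` of compact subsets of a topological space `T`,
closed under arbitrary intersections, with `⋂₀ 𝒜` (written `∅'` in the literature) nonempty, and
satisfying the Shape hypothesis. The last three fields are the part of the Ivanoff-Merzbach
framework (closed under closures of bounded increasing unions; connected members and
approximation from above) which guarantees that members of `𝒜` can be joined continuously inside
`𝒜`, and that interiors of finite unions of members behave as they do for rectangles `[0, t]`. -/
structure IsIndexingCollection {T : Type*} [TopologicalSpace T] (𝒜 : Set (Set T)) : Prop where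
  nonempty : 𝒜.Nonempty
  isCompact : ∀ A ∈ 𝒜, IsCompact A
  sInter_nonempty : (⋂₀ 𝒜).Nonempty
  sInter_mem : ∀ S ⊆ 𝒜, S.Nonempty → ⋂₀ S ∈ 𝒜
  shape : ∀ A ∈ 𝒜, ∀ F : Finset (Set T), (F : Set (Set T)) ⊆ 𝒜 →
    A ⊆ ⋃₀ (F : Set (Set T)) → ∃ A' ∈ F, A ⊆ A'
  /-- An increasing sequence of members bounded by a member has the closure of its union
  in `𝒜`. -/
  closure_iUnion_mem : ∀ A : ℕ → Set T, (∀ n, A n ∈ 𝒜) → Monotone A →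
    ∀ V ∈ 𝒜, (∀ n, A n ⊆ V) → closure (⋃ n, A n) ∈ 𝒜
  /-- There are no gaps: between two distinct nested members there is another one. -/
  exists_between : ∀ U ∈ 𝒜, ∀ V ∈ 𝒜, U ⊂ V → ∃ W ∈ 𝒜, U ⊂ W ∧ W ⊂ V
  /-- The Shape hypothesis for interiors. -/
  shape_interior : ∀ U ∈ 𝒜, ∀ F : Finset (Set T), (F : Set (Set T)) ⊆ 𝒜 →
    U ⊆ interior (⋃₀ (F : Set (Set T))) → ∃ A' ∈ F, U ⊆ interior A'

/-- The conditions on the measure: the members of `𝒜` are measurable of finite measure,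
`m ∅' = 0`, and `m` is monotonically continuous on `𝒜`. -/
structure IsIndexingMeasure {T : Type*} [TopologicalSpace T] [MeasurableSpace T]
    (𝒜 : Set (Set T)) (m : Measure T) : Prop where
  measurableSet : ∀ A ∈ 𝒜, MeasurableSet A
  lt_top : ∀ A ∈ 𝒜, m A < ⊤
  sInter_eq_zero : m (⋂₀ 𝒜) = 0
  tendsto_closure : ∀ A : ℕ → Set T, (∀ n, A n ∈ 𝒜) → Monotone A →
    closure (⋃ n, A n) ∈ 𝒜 → Tendsto (fun n => m (A n)) atTop (𝓝 (m (closure (⋃ n, A n))))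

/-- `𝒜(u)`: the finite unions of members of `𝒜`. -/
def finiteUnions {T : Type*} (𝒜 : Set (Set T)) : Set (Set T) :=
  {B | ∃ F : Finset (Set T), (F : Set (Set T)) ⊆ 𝒜 ∧ B = ⋃₀ (F : Set (Set T))}

/-- `F` is the extremal representation of `B`: `B` is the union of the members of `F`, which
belong to `𝒜` and none of which contains another one. -/
def IsExtremalRepresentation {T : Type*} (𝒜 : Set (Set T)) (F : Finset (Set T)) (B : Set T) :
    Prop :=
  (F : Set (Set T)) ⊆ 𝒜 ∧ ⋃₀ (F : Set (Set T)) = B ∧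
    IsAntichain (fun U V : Set T => U ⊆ V) (F : Set (Set T))

/-- The semilattice of all intersections of one or more members of `F`. -/
def semilattice {T : Type*} (F : Finset (Set T)) : Set (Set T) :=
  {U | ∃ G : Finset (Set T), G ⊆ F ∧ G.Nonempty ∧ U = ⋂₀ (G : Set (Set T))}

/-- The class `𝒜_C` attached to `C = A \ B`, where `F` is the extremal representation of `B`:
the members of the semilattice of `F` that are not contained in the interior of `B`. -/
def borderSets {T : Type*} [TopologicalSpace T] (F : Finset (Set T)) (B : Set T) :
    Set (Set T) :=
  {U | U ∈ semilattice F ∧ ¬ U ⊆ interior B}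

section RandomField

variable {T Ω : Type*} {𝒜 : Set (Set T)}

/-- The σ-algebra generated by the variables `X_U`, for the members `U` of `𝒜` lying in `S`. -/
abbrev sigmaOf (X : 𝒜 → Ω → ℝ) (S : Set (Set T)) : MeasurableSpace Ω :=
  ⨆ (U : 𝒜) (_ : (U : Set T) ∈ S), MeasurableSpace.comap (X U) inferInstance

/-- The natural filtration: `ℱ_A` is generated by the `X_U`, `U ∈ 𝒜`, `U ⊆ A`. -/
abbrev naturalFiltration (X : 𝒜 → Ω → ℝ) (A : 𝒜) : MeasurableSpace Ω :=
  sigmaOf X {U | U ⊆ (A : Set T)}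

/-- `ℱ_B`, the supremum of the `ℱ_A` with `A ∈ 𝒜`, `A ⊆ B`. -/
abbrev unionFiltration (X : 𝒜 → Ω → ℝ) (B : Set T) : MeasurableSpace Ω :=
  ⨆ (A : 𝒜) (_ : (A : Set T) ⊆ B), naturalFiltration X A

/-- The strong past `𝒢*_C`, the supremum of the `ℱ_B` with `B ∈ 𝒜(u)`, `B ∩ C = ∅`. -/
abbrev strongPast (X : 𝒜 → Ω → ℝ) (C : Set T) : MeasurableSpace Ω :=
  ⨆ (B : Set T) (_ : B ∈ finiteUnions 𝒜 ∧ B ∩ C = ∅), unionFiltration X B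

/-- `L²`-monotone inner- and outer-continuity. -/
def IsL2MonotoneContinuous [TopologicalSpace T] [MeasurableSpace Ω] (X : 𝒜 → Ω → ℝ)
    (P : Measure Ω) : Prop :=
  (∀ (U : ℕ → 𝒜) (W : 𝒜), Monotone U → (W : Set T) = closure (⋃ n, (U n : Set T)) →
    Tendsto (fun n => ∫ ω, |X (U n) ω - X W ω| ^ 2 ∂P) atTop (𝓝 0)) ∧
  (∀ (V : ℕ → 𝒜) (W : 𝒜), Antitone V → (W : Set T) = ⋂ n, (V n : Set T) →
    Tendsto (fun n => ∫ ω, |X (V n) ω - X W ω| ^ 2 ∂P) atTop (𝓝 0))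

/-- `m`-stationarity. -/
def IsMStationary [MeasurableSpace T] [MeasurableSpace Ω] (X : 𝒜 → Ω → ℝ) (m : Measure T)
    (P : Measure Ω) : Prop :=
  ∀ (k : ℕ) (V : 𝒜) (U A : Fin k → 𝒜), Monotone U → Monotone A →
    (∀ i, (V : Set T) ⊆ (U i : Set T)) →
    (∀ i, m ((U i : Set T) \ (V : Set T)) = m (A i : Set T)) →
    IdentDistrib (fun ω i => X (U i) ω) (fun ω i => X (A i) ω) P P

/-- The `𝒞`-Markov property with respect to the natural filtration, for nonempty increments
`C = A \ B`, `B ⊆ A`. -/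
def IsCMarkov [TopologicalSpace T] [MeasurableSpace Ω] (X : 𝒜 → Ω → ℝ) (P : Measure Ω) : Prop :=
  ∀ (A : 𝒜) (B : Set T), B ∈ finiteUnions 𝒜 → B ⊆ (A : Set T) → ((A : Set T) \ B).Nonempty →
    ∀ F : Finset (Set T), IsExtremalRepresentation 𝒜 F B →
    ∀ f : ℝ → ℝ, Measurable f → (∀ x, 0 ≤ f x) → Integrable (fun ω => f (X A ω)) P →
      P[fun ω => f (X A ω) | strongPast X ((A : Set T) \ B)]
        =ᵐ[P] P[fun ω => f (X A ω) | sigmaOf X (borderSets F B)]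

/-- Stationary set-indexed Ornstein-Uhlenbeck process, for some positive parameters. -/
def IsStationarySetIndexedOU [MeasurableSpace T] [MeasurableSpace Ω] (X : 𝒜 → Ω → ℝ)
    (m : Measure T) (P : Measure Ω) : Prop :=
  IsGaussianProcess X P ∧ (∀ U, ∫ ω, X U ω ∂P = 0) ∧
  ∃ lam σ : ℝ, 0 < lam ∧ 0 < σ ∧ ∀ U V : 𝒜,
    ∫ ω, X U ω * X V ω ∂P =
      σ ^ 2 / (2 * lam) * Real.exp (-lam * m.real (symmDiff (U : Set T) (V : Set T)))

end RandomField

end SetIndexedOU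

/-! From the covariance to the three properties, only the Markov property is not a direct
computation. For `C = A \ ⋃ F` put `I S = A ∩ ⋂ S` and `Z = ∑ (-1)^|S| exp (λ (m (I S) - m A)) X_{I
S}` over `S ⊆ F`. If `U` misses `C`, Shape puts `U ∩ A` inside one `i ∈ F`; adjoining or removing
`i` preserves `U ∩ I S` and flips the sign, so `Z` is uncorrelated with, hence independent of, the
strong past. The same toggling cancels the terms with `I S` inside the interior of `⋃ F`, this time
because a member cannot be relatively open in a larger one. What remains is `X_A` plus a combination
of border variables, and freezing gives the Markov property (`isCMarkov_of_covariance`).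

Conversely, stationarity makes the covariance of nested members a function `ρ` of the measure of
their difference. The Markov property at one member `B` factorizes covariances through `X_B`. Taking
`∅'` as the first set makes `ρ / ρ 0` multiplicative, and outer continuity with non-degeneracy makes
it a decaying exponential. Factorizing through `U ∩ V` then handles arbitrary pairs. The absence of
gaps supplies members of every intermediate measure (`exists_measure_eq`). -/

theorem IsChain.exists_monotone_seq {α : Type*} [Preorder α] {c : Set α}
    (hc : IsChain (· ≤ ·) c) (f : ℕ → α) (hf : ∀ n, f n ∈ c) :
    ∃ g : ℕ → α, Monotone g ∧ ∀ n, g n ∈ c ∧ f n ≤ g n := by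
  have key : ∀ x ∈ c, ∀ y ∈ c, ∃ z ∈ c, x ≤ z ∧ y ≤ z := fun x hx y hy => by
    rcases hc.total hx hy with h | h
    · exact ⟨y, hy, h, le_rfl⟩
    · exact ⟨x, hx, le_rfl, h⟩
  choose! s hsc hs1 hs2 using key
  let g : ℕ → α := fun n => Nat.rec (f 0) (fun n x => s x (f (n + 1))) n
  have hg : ∀ n, g n ∈ c := by
    intro n
    induction n with
    | zero => exact hf 0
    | succ n ih => exact hsc _ ih _ (hf _)
  refine ⟨g, monotone_nat_of_le_succ fun n => hs1 _ (hg n) _ (hf _), fun n => ⟨hg n, ?_⟩⟩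
  cases n with
  | zero => exact le_rfl
  | succ n => exact hs2 _ (hg n) _ (hf _)

/-! ### Absence of gaps and intermediate values of the measure -/

namespace SetIndexedOU

section Indexing

variable {T : Type*} [MetricSpace T] {𝒜 : Set (Set T)}

theorem IsIndexingCollection.inter_mem (h : IsIndexingCollection 𝒜) {U V : Set T}
    (hU : U ∈ 𝒜) (hV : V ∈ 𝒜) : U ∩ V ∈ 𝒜 := by
  rw [← sInter_pair]
  exact h.sInter_mem _ (by simp [insert_subset_iff, hU, hV]) (by simp)

theorem IsIndexingCollection.sInter_self_mem (h : IsIndexingCollection 𝒜) : ⋂₀ 𝒜 ∈ 𝒜 :=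
  h.sInter_mem _ subset_rfl h.nonempty

/-- A member `V` of `𝒜` cannot be relatively open in a strictly larger member. -/
theorem IsIndexingCollection.eq_of_inter_subset_interior (h : IsIndexingCollection 𝒜)
    {V V' K : Set T} (hV : V ∈ 𝒜) (hV' : V' ∈ 𝒜) (hVV' : V ⊆ V') (hinter : V' ∩ K ⊆ V)
    (hK : V ⊆ interior K) : V = V' := by
  by_contra hne
  let S : Set (Set T) := {W | W ∈ 𝒜 ∧ V ⊂ W ∧ W ⊆ V'}
  -- Strict inclusion `V ⊂ W` is not stable under intersections of chains, but sticking out of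
  -- `interior K` is, by compactness. So a minimal member above `V` exists, and it would leave a
  -- gap.
  have hout : ∀ W ∈ S, (W \ interior K).Nonempty := by
    rintro W ⟨-, h1, h2⟩
    obtain ⟨x, hx, hxV⟩ := exists_of_ssubset h1
    exact ⟨x, hx, fun hxK => hxV (hinter ⟨h2 hx, interior_subset hxK⟩)⟩
  obtain ⟨W, -, hW⟩ := zorn_superset_nonempty S (by
    intro c hcS hc hcne
    refine ⟨⋂₀ c, ⟨h.sInter_mem _ (fun W hW => (hcS hW).1) hcne, ?_, ?_⟩,
      fun s hs => sInter_subset_of_mem hs⟩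
    · have hne' : (⋂ W : c, ((W : Set T) \ interior K)).Nonempty := by
        have : Nonempty c := hcne.to_subtype
        refine IsCompact.nonempty_iInter_of_directed_nonempty_isCompact_isClosed _ ?_
          (fun W => hout _ (hcS W.2))
          (fun W => (h.isCompact _ (hcS W.2).1).diff isOpen_interior)
          (fun W => ((h.isCompact _ (hcS W.2).1).diff isOpen_interior).isClosed)
        intro A B
        rcases hc.total A.2 B.2 with hAB | hAB
        · exact ⟨A, subset_rfl, sdiff_subset_sdiff_left hAB⟩
        · exact ⟨B, sdiff_subset_sdiff_left hAB, subset_rfl⟩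
      obtain ⟨x, hx⟩ := hne'
      simp only [mem_iInter, Set.mem_sdiff, Subtype.forall] at hx
      refine ⟨subset_sInter fun W hW => (hcS hW).2.1.subset, fun hsub => ?_⟩
      obtain ⟨W, hW⟩ := hcne
      exact (hx W hW).2 (hK (hsub fun W hW => (hx W hW).1))
    · obtain ⟨W, hW⟩ := hcne
      exact (sInter_subset_of_mem hW).trans (hcS hW).2.2) V'
    ⟨hV', hVV'.ssubset_of_ne hne, subset_rfl⟩
  obtain ⟨W', hW'𝒜, h1, h2⟩ := h.exists_between V hV W hW.prop.1 hW.prop.2.1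
  exact h2.2 (hW.le_of_le ⟨hW'𝒜, h1, h2.subset.trans hW.prop.2.2⟩ h2.subset)

variable [MeasurableSpace T] {m : Measure T}

/-- A chain in `𝒜` of sets of measure at most `t`, bounded by a member of `𝒜`, has an upper bound
in `𝒜` of measure at most `t`. -/
theorem IsIndexingCollection.exists_upperBound_chain (h : IsIndexingCollection 𝒜)
    (hm : IsIndexingMeasure 𝒜 m) {c : Set (Set T)} (hc𝒜 : c ⊆ 𝒜) (hc : IsChain (· ⊆ ·) c)
    (hne : c.Nonempty) {V : Set T} (hV : V ∈ 𝒜) (hcV : ∀ W ∈ c, W ⊆ V) {t : ENNReal}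
    (ht : ∀ W ∈ c, m W ≤ t) : ∃ W ∈ 𝒜, W ⊆ V ∧ m W ≤ t ∧ ∀ A ∈ c, A ⊆ W := by
  -- Only sequences have closures of unions in `𝒜`; a countable dense subset of `⋃₀ c` reduces the
  -- chain to a sequence.
  have hsep : TopologicalSpace.IsSeparable (⋃₀ c) :=
    (h.isCompact V hV).isSeparable.mono (sUnion_subset hcV)
  obtain ⟨d, hd, hdc, hdd⟩ := hsep.exists_countable_dense_subset
  have hdne : d.Nonempty := by
    by_contra hempty
    rw [not_nonempty_iff_eq_empty] at hempty
    obtain ⟨A, hA⟩ := hne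
    obtain ⟨x, hx⟩ := h.sInter_nonempty
    simpa [hempty] using hdd (mem_sUnion_of_mem (mem_sInter.1 hx A (hc𝒜 hA)) hA)
  obtain ⟨x, rfl⟩ := hdc.exists_eq_range hdne
  have hx : ∀ n, ∃ A ∈ c, x n ∈ A := fun n => hd (mem_range_self n)
  choose f hfc hxf using hx
  obtain ⟨g, hg, hgf⟩ := IsChain.exists_monotone_seq (α := Set T) hc f hfc
  have hVc : IsClosed V := (h.isCompact V hV).isClosed
  have hmem := h.closure_iUnion_mem g (fun n => hc𝒜 (hgf n).1) hg V hV fun n => hcV _ (hgf n).1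
  refine ⟨_, hmem, closure_minimal (iUnion_subset fun n => hcV _ (hgf n).1) hVc,
    le_of_tendsto' (hm.tendsto_closure g (fun n => hc𝒜 (hgf n).1) hg hmem)
      fun n => ht _ (hgf n).1, fun A hA => ?_⟩
  refine (subset_sUnion_of_mem hA).trans (hdd.trans (closure_mono ?_))
  rintro _ ⟨n, rfl⟩
  exact mem_iUnion.2 ⟨n, (hgf n).2 (hxf n)⟩

/-- Inside a compact metric space an intersection of closed sets is already a countable one, so
continuity of `m` from above applies. -/
theorem IsIndexingMeasure.le_measure_sInter_chain (h : IsIndexingCollection 𝒜)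
    (hm : IsIndexingMeasure 𝒜 m) {c : Set (Set T)} (hc𝒜 : c ⊆ 𝒜) (hc : IsChain (· ⊆ ·) c)
    (hne : c.Nonempty) {t : ENNReal} (ht : ∀ W ∈ c, t ≤ m W) : t ≤ m (⋂₀ c) := by
  obtain ⟨V, hVc⟩ := hne
  have : CompactSpace V := isCompact_iff_compactSpace.1 (h.isCompact V (hc𝒜 hVc))
  have : Nonempty c := ⟨⟨V, hVc⟩⟩
  obtain ⟨s, hs⟩ := eq_closed_inter_nat
    (fun W : c => (Subtype.val ⁻¹' (W : Set T) : Set V))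
    fun W => (h.isCompact _ (hc𝒜 W.2)).isClosed.preimage continuous_subtype_val
  obtain ⟨g, hg, hgf⟩ := IsChain.exists_monotone_seq (α := (Set T)ᵒᵈ) (c := OrderDual.ofDual ⁻¹' c)
    (fun A hA B hB hAB => (hc hB hA hAB.symm)) (fun n => OrderDual.toDual
      -- `V` comes first because the countable reduction only holds within `V`.
      (Nat.casesOn n V fun k => (s k : Set T)))
    (fun n => by
      cases n with
      | zero => exact hVc
      | succ k => exact (s k).2)
  have hgc : ∀ n, OrderDual.ofDual (g n) ∈ c := fun n => (hgf n).1
  have hanti : Antitone fun n => OrderDual.ofDual (g n) := fun a b hab => hg hab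
  have heq : ⋂ n, OrderDual.ofDual (g n) = ⋂₀ c := by
    refine Subset.antisymm (fun x hx => ?_) (subset_iInter fun n => sInter_subset_of_mem (hgc n))
    rw [mem_iInter] at hx
    have hxV : x ∈ V := (hgf 0).2 (hx 0)
    have hxs : (⟨x, hxV⟩ : V) ∈ ⋂ n, (Subtype.val ⁻¹' (s n : Set T) : Set V) :=
      mem_iInter.2 fun n => (hgf (n + 1)).2 (hx (n + 1))
    rw [hs, mem_iInter] at hxs
    exact mem_sInter.2 fun A hA => hxs ⟨A, hA⟩
  rw [← heq]
  exact ge_of_tendsto' (tendsto_measure_iInter_atTop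
    (fun n => (hm.measurableSet _ (hc𝒜 (hgc n))).nullMeasurableSet) hanti
    ⟨0, (hm.lt_top _ (hc𝒜 (hgc 0))).ne⟩) fun n => ht _ (hgc n)

/-- Intermediate value property of `m` on `𝒜`. -/
theorem IsIndexingCollection.exists_measure_eq (h : IsIndexingCollection 𝒜)
    (hm : IsIndexingMeasure 𝒜 m) {U V : Set T} (hU : U ∈ 𝒜) (hV : V ∈ 𝒜) (hUV : U ⊆ V)
    {t : ENNReal} (hUt : m U ≤ t) (htV : t ≤ m V) : ∃ W ∈ 𝒜, U ⊆ W ∧ W ⊆ V ∧ m W = t := by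
  -- `W₁` is maximal with measure at most `t`, and `W₂` minimal above it with measure at least `t`.
  -- A member strictly between would contradict one of the two, so they coincide.
  obtain ⟨W₁, hUW₁, hW₁⟩ := zorn_subset_nonempty {W | W ∈ 𝒜 ∧ W ⊆ V ∧ m W ≤ t} (by
    intro c hcS hc hcne
    obtain ⟨W, hW, h1, h2, h3⟩ := h.exists_upperBound_chain hm (fun A hA => (hcS hA).1) hc hcne hV
      (fun A hA => (hcS hA).2.1) (fun A hA => (hcS hA).2.2)
    exact ⟨W, ⟨hW, h1, h2⟩, h3⟩) U ⟨hU, hUV, hUt⟩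
  obtain ⟨W₂, hW₂V, hW₂⟩ := zorn_superset_nonempty {W | W ∈ 𝒜 ∧ W₁ ⊆ W ∧ t ≤ m W} (by
    intro c hcS hc hcne
    exact ⟨⋂₀ c, ⟨h.sInter_mem _ (fun A hA => (hcS hA).1) hcne,
      subset_sInter fun A hA => (hcS hA).2.1,
      hm.le_measure_sInter_chain h (fun A hA => (hcS hA).1) hc hcne fun A hA => (hcS hA).2.2⟩,
      fun A hA => sInter_subset_of_mem hA⟩) V ⟨hV, hW₁.prop.2.1, htV⟩
  refine ⟨W₁, hW₁.prop.1, hUW₁, hW₁.prop.2.1, le_antisymm hW₁.prop.2.2 ?_⟩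
  suffices W₁ = W₂ by rw [this]; exact hW₂.prop.2.2
  by_contra hne
  obtain ⟨W, hW, h1, h2⟩ := h.exists_between W₁ hW₁.prop.1 W₂ hW₂.prop.1
    (hW₂.prop.2.1.ssubset_of_ne hne)
  rcases le_total (m W) t with hle | hle
  · exact h1.2 (hW₁.le_of_ge ⟨hW, h2.subset.trans hW₂V, hle⟩ h1.subset)
  · exact h2.2 (hW₂.le_of_le ⟨hW, h1.subset, hle⟩ h2.subset)

end Indexing

end SetIndexedOU

/-! ### Freezing, Gaussian laws and independence -/

namespace ProbabilityTheory

variable {Ω : Type*} {ℋ 𝒢 m₀ : MeasurableSpace Ω} {P : Measure Ω}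

/-- By independence the conditional distribution of `Z` given `X` is the constant kernel at the law
of `Z`. -/
theorem IndepFun.condExp_prod_ae_eq {β : Type*} [MeasurableSpace β] [IsProbabilityMeasure P]
    {X : Ω → β} {Z : Ω → ℝ} (hX : Measurable X) (hZ : Measurable Z) (h : IndepFun X Z P)
    {f : β × ℝ → ℝ} (hf : Measurable f) (hint : Integrable (fun ω => f (X ω, Z ω)) P) :
    P[fun ω => f (X ω, Z ω) | MeasurableSpace.comap X inferInstance]
      =ᵐ[P] fun ω => ∫ z, f (X ω, z) ∂(P.map Z) := by
  have : IsProbabilityMeasure (P.map Z) := Measure.isProbabilityMeasure_map hZ.aemeasurable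
  have hc := (condDistrib_ae_eq_iff_measure_eq_compProd (μ := P) (Y := Z) X hZ.aemeasurable
    (Kernel.const β (P.map Z))).2 (by
      rw [Measure.compProd_const]
      exact (indepFun_iff_map_prod_eq_prod_map_map hX.aemeasurable hZ.aemeasurable).1 h)
  refine (condExp_prod_ae_eq_integral_condDistrib hX hZ.aemeasurable hf.stronglyMeasurable
    hint).trans ?_
  filter_upwards [ae_of_ae_map hX.aemeasurable hc] with ω hω
  rw [hω, Kernel.const_apply]

/-- Freezing lemma: if `Y` is `𝒢`-measurable and `Z` is independent of `𝒢`, conditioning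
`f (Y + Z)` on `𝒢` integrates out `Z`. -/
theorem condExp_comp_add_of_indep [IsProbabilityMeasure P] (h𝒢 : 𝒢 ≤ m₀)
    {Y Z : Ω → ℝ} (hY : Measurable[𝒢] Y) (hZ : Measurable Z)
    (hind : Indep 𝒢 (MeasurableSpace.comap Z inferInstance) P)
    {f : ℝ → ℝ} (hf : Measurable f) (hint : Integrable (fun ω => f (Y ω + Z ω)) P) :
    P[fun ω => f (Y ω + Z ω) | 𝒢] =ᵐ[P] fun ω => ∫ z, f (Y ω + z) ∂(P.map Z) := by
  -- The identity into `(Ω, 𝒢)` exhibits `𝒢` as generated by a random variable.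
  have hid : Measurable[m₀, 𝒢] (id : Ω → Ω) := fun s hs => h𝒢 s hs
  have hI : @IndepFun Ω Ω ℝ m₀ 𝒢 _ id Z P := by
    refine (@IndepFun_iff_Indep Ω Ω ℝ m₀ 𝒢 _ id Z P).2 ?_
    rwa [MeasurableSpace.comap_id]
  have hfm : @Measurable (Ω × ℝ) ℝ (@Prod.instMeasurableSpace Ω ℝ 𝒢 _) _
      fun p => f (Y p.1 + p.2) :=
    hf.comp ((hY.comp (@measurable_fst Ω ℝ 𝒢 _)).add (@measurable_snd Ω ℝ 𝒢 _))
  have key := @IndepFun.condExp_prod_ae_eq Ω m₀ P Ω 𝒢 _ id Z hid hZ hI _ hfm hint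
  rwa [MeasurableSpace.comap_id] at key

/-- Freezing applies to both σ-algebras and yields the same function of `Y`. -/
theorem condExp_comp_add_eq_of_le [IsProbabilityMeasure P]
    (hℋ : ℋ ≤ 𝒢) (h𝒢 : 𝒢 ≤ m₀) {Y Z : Ω → ℝ} (hY : Measurable[ℋ] Y) (hZ : Measurable Z)
    (hind : Indep 𝒢 (MeasurableSpace.comap Z inferInstance) P)
    {f : ℝ → ℝ} (hf : Measurable f) (hint : Integrable (fun ω => f (Y ω + Z ω)) P) :
    P[fun ω => f (Y ω + Z ω) | 𝒢] =ᵐ[P] P[fun ω => f (Y ω + Z ω) | ℋ] :=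
  (condExp_comp_add_of_indep h𝒢 (hY.mono hℋ le_rfl) hZ hind hf hint).trans
    (condExp_comp_add_of_indep (hℋ.trans h𝒢) hY hZ (indep_of_indep_of_le_left hind hℋ)
      hf hint).symm

/-- Two Gaussian vectors with the same means and the same covariances have the same law. -/
theorem HasGaussianLaw.identDistrib_of_covariance_eq {ι : Type*} [Fintype ι]
    {X Y : ι → Ω → ℝ} (hX : HasGaussianLaw (fun ω i => X i ω) P)
    (hY : HasGaussianLaw (fun ω i => Y i ω) P) (hmean : ∀ i, ∫ ω, X i ω ∂P = ∫ ω, Y i ω ∂P)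
    (hcov : ∀ i j, cov[X i, X j; P] = cov[Y i, Y j; P]) :
    IdentDistrib (fun ω i => X i ω) (fun ω i => Y i ω) P P := by
  classical
  have := hX.isProbabilityMeasure
  refine ⟨hX.aemeasurable, hY.aemeasurable, ?_⟩
  have := hX.isGaussian_map
  have := hY.isGaussian_map
  have hsum : ∀ (L : StrongDual ℝ (ι → ℝ)) (Z : ι → Ω → ℝ),
      (fun ω => L fun i => Z i ω) = fun ω => ∑ i, L (Pi.single i 1) * Z i ω := by
    intro L Z
    ext ω
    conv_lhs => rw [pi_eq_sum_univ' (fun i => Z i ω), map_sum]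
    refine Finset.sum_congr rfl fun i _ => ?_
    rw [map_smul, smul_eq_mul, mul_comm]
  have h2 : ∀ Z : ι → Ω → ℝ, HasGaussianLaw (fun ω i => Z i ω) P → ∀ i, MemLp (Z i) 2 P :=
    fun Z hZ i => (hZ.eval i).memLp_two
  have hvar : ∀ Z : ι → Ω → ℝ, HasGaussianLaw (fun ω i => Z i ω) P → ∀ L : StrongDual ℝ (ι → ℝ),
      Var[fun ω => L fun i => Z i ω; P] = ∑ i, ∑ j, L (Pi.single i 1) * (L (Pi.single j 1) *
        cov[Z i, Z j; P]) := by
    intro Z hZ L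
    rw [hsum, variance_fun_sum fun i => (h2 Z hZ i).const_mul _]
    simp_rw [covariance_const_mul_left, covariance_const_mul_right]
  have hint : ∀ Z : ι → Ω → ℝ, HasGaussianLaw (fun ω i => Z i ω) P → ∀ L : StrongDual ℝ (ι → ℝ),
      ∫ ω, (L fun i => Z i ω) ∂P = ∑ i, L (Pi.single i 1) * ∫ ω, Z i ω ∂P := by
    intro Z hZ L
    rw [hsum, integral_finsetSum _ fun i _ => (hZ.eval i).integrable.const_mul _]
    simp_rw [integral_const_mul]
  apply Measure.ext_of_charFunDual
  ext L
  rw [hX.charFunDual_map_eq_fun, hY.charFunDual_map_eq_fun, hvar X hX, hvar Y hY, hint X hX,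
    hint Y hY]
  simp_rw [hmean, hcov]

/-- In a Gaussian process, a linear combination of the variables which is uncorrelated with the
variables indexed by `S` is independent of them. -/
theorem IsGaussianProcess.indep_linearCombination {ι κ : Type*} {X : ι → Ω → ℝ}
    (hX : IsGaussianProcess X P) (hXm : ∀ i, Measurable (X i)) {S : Set ι} (J : Finset κ)
    (v : κ → ι) (c : κ → ℝ) (h : ∀ i ∈ S, cov[X i, fun ω => ∑ j ∈ J, c j * X (v j) ω; P] = 0) :
    Indep (⨆ i ∈ S, MeasurableSpace.comap (X i) inferInstance)
      (MeasurableSpace.comap (fun ω => ∑ j ∈ J, c j * X (v j) ω) inferInstance) P := by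
  classical
  have hZm : Measurable fun ω => ∑ j ∈ J, c j * X (v j) ω :=
    Finset.measurable_sum _ fun j _ => (hXm _).const_mul _
  have hG : IsGaussianProcess
      (Sum.elim (fun (i : S) => X i) (fun (_ : Unit) ω => ∑ j ∈ J, c j * X (v j) ω)) P := by
    refine hX.of_isGaussianProcess fun s => ?_
    rcases s with i | _
    · exact ⟨{i.1}, .proj ⟨i.1, by simp⟩, fun ω => rfl⟩
    · refine ⟨J.image v, ∑ j : J, c j • .proj ⟨v j, Finset.mem_image_of_mem v j.2⟩, fun ω => ?_⟩
      simp [← Finset.sum_coe_sort J]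
  have hind := hG.indepFun_of_covariance_eq_zero (fun i => (hXm i).aemeasurable)
    (fun _ => hZm.aemeasurable) fun i _ => h i i.2
  rw [IndepFun_iff_Indep] at hind
  refine indep_of_indep_of_le_left (indep_of_indep_of_le_right hind ?_) ?_
  · rintro _ ⟨s, hs, rfl⟩
    exact ⟨(fun g => g ()) ⁻¹' s, measurable_pi_apply _ hs, rfl⟩
  · refine iSup₂_le fun i hi => ?_
    rintro _ ⟨s, hs, rfl⟩
    exact ⟨(fun g => g ⟨i, hi⟩) ⁻¹' s, measurable_pi_apply _ hs, rfl⟩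

end ProbabilityTheory

/-! ### A sign-reversing involution -/

namespace Finset

variable {α : Type*} [DecidableEq α]

/-- Adjoin `i` to `S` if it is absent, remove it if it is present. -/
def toggle (i : α) (S : Finset α) : Finset α := if i ∈ S then S.erase i else insert i S

theorem toggle_toggle (i : α) (S : Finset α) : toggle i (toggle i S) = S := by
  by_cases h : i ∈ S <;> simp [toggle, h]

theorem toggle_subset {i : α} {S F : Finset α} (hi : i ∈ F) (hS : S ⊆ F) : toggle i S ⊆ F := by
  unfold toggle
  split_ifs
  · exact (erase_subset _ _).trans hS
  · exact insert_subset hi hS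

theorem toggle_ne (i : α) (S : Finset α) : toggle i S ≠ S := by
  by_cases h : i ∈ S <;> simp [toggle, h]

theorem neg_one_pow_card_toggle (i : α) (S : Finset α) :
    (-1 : ℝ) ^ (toggle i S).card = -(-1 : ℝ) ^ S.card := by
  by_cases h : i ∈ S
  · have := card_erase_add_one h
    rw [toggle, if_pos h, ← this, pow_succ]
    ring
  · rw [toggle, if_neg h, card_insert_of_notMem h, pow_succ]
    ring

/-- An alternating sum over a family of finite sets vanishes when toggling an element (chosen
in a way that is invariant under toggling) preserves the family and the summand. -/
theorem sum_neg_one_pow_card_eq_zero (Q : Finset (Finset α)) (i : Finset α → α)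
    (h : Finset α → ℝ) (hQ : ∀ S ∈ Q, toggle (i S) S ∈ Q)
    (hi : ∀ S ∈ Q, i (toggle (i S) S) = i S) (hh : ∀ S ∈ Q, h (toggle (i S) S) = h S) :
    ∑ S ∈ Q, (-1 : ℝ) ^ S.card * h S = 0 :=
  sum_involution (fun S _ => toggle (i S) S)
    (fun S hS => by rw [hh S hS, neg_one_pow_card_toggle]; ring) (fun S _ _ => toggle_ne _ _) hQ
    fun S hS => by
      rw [hi S hS, toggle_toggle]

end Finset

/-! ### The Markov property from the covariance -/

namespace SetIndexedOU

section SigmaAlgebra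

variable {T Ω : Type*} {𝒜 : Set (Set T)}

theorem sigmaOf_le [MeasurableSpace Ω] {X : 𝒜 → Ω → ℝ} (hX : ∀ U, Measurable (X U))
    (S : Set (Set T)) :
    sigmaOf X S ≤ ‹MeasurableSpace Ω› :=
  iSup₂_le fun U _ => (hX U).comap_le

/-- A member missing `C` is itself a finite union missing `C`, so the nested suprema collapse to one
generating class. -/
theorem strongPast_eq (X : 𝒜 → Ω → ℝ) (C : Set T) :
    strongPast X C = sigmaOf X {U | U ∩ C = ∅} := by
  refine le_antisymm ?_ ?_
  · refine iSup₂_le fun B hB => iSup₂_le fun A hA => iSup₂_le fun U hU => ?_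
    have : (U : Set T) ∩ C = ∅ :=
      subset_empty_iff.1 ((inter_subset_inter_left C (Subset.trans hU hA)).trans hB.2.subset)
    exact le_iSup₂_of_le U this le_rfl
  · refine iSup₂_le fun U hU => ?_
    refine le_iSup₂_of_le (U : Set T) ⟨⟨{(U : Set T)}, by simp, by simp⟩, hU⟩ ?_
    refine le_iSup₂_of_le U subset_rfl ?_
    exact le_iSup₂_of_le U (subset_rfl : (U : Set T) ⊆ U) le_rfl

theorem measurable_sigmaOf (X : 𝒜 → Ω → ℝ) {S : Set (Set T)} {U : 𝒜} (hU : (U : Set T) ∈ S) :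
    Measurable[sigmaOf X S] (X U) :=
  (comap_measurable (X U)).mono (le_iSup₂_of_le U hU le_rfl) le_rfl

end SigmaAlgebra

variable {T : Type*} [MetricSpace T] {𝒜 : Set (Set T)}

open Classical in
/-- If the intersection `A ∩ ⋂₀ S` lies in the interior of `i`, then adjoining or removing `i`
does not change it. -/
theorem IsIndexingCollection.inter_sInter_toggle (h : IsIndexingCollection 𝒜) {A : Set T}
    (hA : A ∈ 𝒜) {S : Finset (Set T)} (hS : (S : Set (Set T)) ⊆ 𝒜) {i : Set T}
    (hi : A ∩ ⋂₀ (S : Set (Set T)) ⊆ interior i) :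
    A ∩ ⋂₀ (Finset.toggle i S : Set (Set T)) = A ∩ ⋂₀ (S : Set (Set T)) := by
  have hmem : ∀ S : Finset (Set T), (S : Set (Set T)) ⊆ 𝒜 → A ∩ ⋂₀ (S : Set (Set T)) ∈ 𝒜 := by
    intro S hS
    rw [← sInter_insert]
    exact h.sInter_mem _ (insert_subset hA hS) (insert_nonempty _ _)
  by_cases hiS : i ∈ S
  · rw [Finset.toggle, if_pos hiS]
    have heq : A ∩ ⋂₀ (S : Set (Set T)) = A ∩ ⋂₀ (S.erase i : Set (Set T)) ∩ i := by
      conv_lhs => rw [← Finset.insert_erase hiS, Finset.coe_insert, sInter_insert]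
      rw [inter_assoc, inter_comm i]
    -- With `i` removed the intersection could only grow; the old one is its trace on `i` and lies
    -- in `interior i`, hence is relatively open in it, so the two agree.
    refine (h.eq_of_inter_subset_interior (hmem S hS)
      (hmem _ fun x hx => hS (Finset.mem_of_mem_erase hx)) ?_ heq.ge hi).symm
    rw [heq]
    exact inter_subset_left
  · rw [Finset.toggle, if_neg hiS, Finset.coe_insert, sInter_insert]
    refine Subset.antisymm (inter_subset_inter_right _ inter_subset_right) ?_
    exact fun x hx => ⟨hx.1, interior_subset (hi hx), hx.2⟩

variable [MeasurableSpace T] {m : Measure T}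

theorem IsIndexingMeasure.real_symmDiff (hm : IsIndexingMeasure 𝒜 m) {U V : Set T} (hU : U ∈ 𝒜)
    (hV : V ∈ 𝒜) : m.real (symmDiff U V) = m.real U + m.real V - 2 * m.real (U ∩ V) := by
  have hUm := hm.measurableSet U hU
  have hVm := hm.measurableSet V hV
  have hUf := (hm.lt_top U hU).ne
  have hVf := (hm.lt_top V hV).ne
  have h1 := measureReal_inter_add_sdiff (μ := m) hVm hUf
  have h2 := measureReal_inter_add_sdiff (μ := m) hUm hVf
  change m.real ((U \ V) ∪ (V \ U)) = _
  rw [measureReal_union disjoint_sdiff_sdiff (hVm.diff hUm)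
    (measure_ne_top_of_subset sdiff_subset hUf) (measure_ne_top_of_subset sdiff_subset hVf)]
  rw [inter_comm] at h2
  linarith

variable {Ω : Type*} [MeasurableSpace Ω] {P : Measure Ω} {X : 𝒜 → Ω → ℝ}

open Classical in
theorem isCMarkov_of_covariance [IsProbabilityMeasure P] (h : IsIndexingCollection 𝒜)
    (hm : IsIndexingMeasure 𝒜 m)
    (hX : ∀ U, Measurable (X U)) (hG : IsGaussianProcess X P) {K lam : ℝ}
    (hcov : ∀ U V : 𝒜, cov[X U, X V; P] =
      K * Real.exp (-lam * m.real (symmDiff (U : Set T) (V : Set T)))) : IsCMarkov X P := by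
  intro A B hB hBA hAB F hF f hf hf0 hfint
  obtain ⟨hF𝒜, rfl, -⟩ := hF
  have hex : ∀ S : Finset (Set T), ∃ I : 𝒜,
      S ⊆ F → (I : Set T) = (A : Set T) ∩ ⋂₀ (S : Set (Set T)) := by
    intro S
    by_cases hS : S ⊆ F
    · refine ⟨⟨(A : Set T) ∩ ⋂₀ (S : Set (Set T)), ?_⟩, fun _ => rfl⟩
      rw [← sInter_insert]
      exact h.sInter_mem _ (insert_subset A.2 ((Finset.coe_subset.2 hS).trans hF𝒜))
        (insert_nonempty _ _)
    · exact ⟨A, fun h => absurd h hS⟩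
  choose I hI using hex
  have hI0 : I ∅ = A := Subtype.ext (by simp [hI ∅ (Finset.empty_subset F)])
  -- The weight cancels `m (I S)` in the covariance, which then depends on `S` only through its sign
  -- and `m (U ∩ I S)`.
  let c : Finset (Set T) → ℝ := fun S =>
    (-1) ^ S.card * Real.exp (lam * (m.real (I S : Set T) - m.real (A : Set T)))
  let Z : Ω → ℝ := fun ω => ∑ S ∈ F.powerset, c S * X (I S) ω
  have hZ : Indep (sigmaOf X {U | U ∩ ((A : Set T) \ ⋃₀ (F : Set (Set T))) = ∅})
      (MeasurableSpace.comap Z inferInstance) P := by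
    refine hG.indep_linearCombination hX
      (S := {U : 𝒜 | (U : Set T) ∩ ((A : Set T) \ ⋃₀ (F : Set (Set T))) = ∅}) F.powerset I c ?_
    intro U hU
    obtain ⟨i, hiF, hUi⟩ := h.shape _ (h.inter_mem U.2 A.2) F hF𝒜 (by
      rintro x ⟨hxU, hxA⟩
      by_contra hx
      exact (Set.ext_iff.1 hU x).1 ⟨hxU, hxA, hx⟩)
    rw [covariance_fun_sum_right' (fun S _ => (hG.hasGaussianLaw_eval _).memLp_two.const_mul _)
      (hG.hasGaussianLaw_eval U).memLp_two]
    have hterm : ∀ S : Finset (Set T), cov[X U, fun ω => c S * X (I S) ω; P] =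
        (-1) ^ S.card * (K * Real.exp (-lam * m.real (U : Set T) - lam * m.real (A : Set T) +
          2 * lam * m.real ((U : Set T) ∩ I S))) := by
      intro S
      rw [covariance_const_mul_right, hcov, hm.real_symmDiff U.2 (I S).2]
      simp only [c]
      rw [mul_assoc, mul_left_comm (Real.exp _), ← Real.exp_add]
      ring_nf
    simp_rw [hterm]
    refine Finset.sum_neg_one_pow_card_eq_zero _ (fun _ => i) _ (fun S hS => ?_) (fun _ _ => rfl)
      fun S hS => ?_
    · exact Finset.mem_powerset.2 (Finset.toggle_subset hiF (Finset.mem_powerset.1 hS))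
    · rw [Finset.mem_powerset] at hS
      have hUI : (U : Set T) ∩ I (Finset.toggle i S) = (U : Set T) ∩ I S := by
        rw [hI _ (Finset.toggle_subset hiF hS), hI _ hS]
        by_cases hiS : i ∈ S
        · have heq : ⋂₀ (S : Set (Set T)) = i ∩ ⋂₀ (S.erase i : Set (Set T)) := by
            conv_lhs => rw [← Finset.insert_erase hiS, Finset.coe_insert, sInter_insert]
          rw [Finset.toggle, if_pos hiS, heq]
          ext x
          exact ⟨fun hx => ⟨hx.1, hx.2.1, hUi ⟨hx.1, hx.2.1⟩, hx.2.2⟩,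
            fun hx => ⟨hx.1, hx.2.1, hx.2.2.2⟩⟩
        · rw [Finset.toggle, if_neg hiS, Finset.coe_insert, sInter_insert]
          ext x
          exact ⟨fun hx => ⟨hx.1, hx.2.1, hx.2.2.2⟩,
            fun hx => ⟨hx.1, hx.2.1, hUi ⟨hx.1, hx.2.1⟩, hx.2.2⟩⟩
      rw [hUI]
  -- Here the toggled element is chosen from the set `I S`, not from `S`; since toggling preserves
  -- `I S`, the choice is unchanged and the map is an involution.
  have hinside : ∀ ω, ∑ S ∈ F.powerset with ((I S : Set T) ⊆ interior (⋃₀ (F : Set (Set T)))),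
      c S * X (I S) ω = 0 := by
    intro ω
    have hch : ∀ V : Set T, ∃ i : Set T, V ∈ 𝒜 → V ⊆ interior (⋃₀ (F : Set (Set T))) →
        i ∈ F ∧ V ⊆ interior i := by
      intro V
      by_cases hV : V ∈ 𝒜 ∧ V ⊆ interior (⋃₀ (F : Set (Set T)))
      · obtain ⟨i, hi⟩ := h.shape_interior V hV.1 F hF𝒜 hV.2
        exact ⟨i, fun _ _ => hi⟩
      · exact ⟨∅, fun h1 h2 => absurd ⟨h1, h2⟩ hV⟩
    choose i hi using hch
    have htog : ∀ S ∈ {S ∈ F.powerset | (I S : Set T) ⊆ interior (⋃₀ (F : Set (Set T)))},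
        Finset.toggle (i (I S)) S ⊆ F ∧ I (Finset.toggle (i (I S)) S) = I S := by
      intro S hS
      rw [Finset.mem_filter, Finset.mem_powerset] at hS
      obtain ⟨hiF, hiI⟩ := hi (I S) (I S).2 hS.2
      have hsub := Finset.toggle_subset hiF hS.1
      refine ⟨hsub, Subtype.ext ?_⟩
      rw [hI _ hsub]
      nth_rw 2 [hI _ hS.1]
      refine h.inter_sInter_toggle A.2 ((Finset.coe_subset.2 hS.1).trans hF𝒜) ?_
      rw [← hI _ hS.1]
      exact hiI
    simp only [c, mul_assoc]
    refine Finset.sum_neg_one_pow_card_eq_zero _ (fun S => i (I S)) _ (fun S hS => ?_)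
      (fun S hS => by rw [(htog S hS).2]) fun S hS => by rw [(htog S hS).2]
    rw [Finset.mem_filter, (htog S hS).2, Finset.mem_powerset]
    exact ⟨(htog S hS).1, (Finset.mem_filter.1 hS).2⟩
  let Q : Finset (Finset (Set T)) :=
    {S ∈ F.powerset | ¬ (I S : Set T) ⊆ interior (⋃₀ (F : Set (Set T)))}
  have hAint : ¬ (A : Set T) ⊆ interior (⋃₀ (F : Set (Set T))) := fun hsub => by
    obtain ⟨x, hxA, hx⟩ := hAB
    exact hx (interior_subset (hsub hxA))
  -- The empty subfamily contributes `X A` itself, with weight `1`; it survives because `A` is not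
  -- covered by `F`.
  have hQ0 : ∅ ∈ Q := by
    rw [Finset.mem_filter, hI0]
    exact ⟨Finset.empty_mem_powerset F, hAint⟩
  let Y : Ω → ℝ := fun ω => -∑ S ∈ Q.erase ∅, c S * X (I S) ω
  have hc0 : c ∅ = 1 := by simp [c, hI0]
  have hXA : ∀ ω, X A ω = Y ω + Z ω := by
    intro ω
    have h1 := Finset.sum_filter_add_sum_filter_not F.powerset
      (fun S => (I S : Set T) ⊆ interior (⋃₀ (F : Set (Set T)))) (fun S => c S * X (I S) ω)
    rw [hinside, zero_add] at h1
    have h2 := Finset.add_sum_erase Q (fun S => c S * X (I S) ω) hQ0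
    simp only [hc0, hI0, one_mul] at h2
    simp only [Y, Z]
    rw [← h1]
    linarith
  have hY : Measurable[sigmaOf X (borderSets F (⋃₀ (F : Set (Set T))))] Y := by
    refine Measurable.neg (Finset.measurable_sum _ fun S hS => Measurable.const_mul ?_ _)
    rw [Finset.mem_erase, Finset.mem_filter, Finset.mem_powerset] at hS
    refine measurable_sigmaOf X ⟨⟨S, hS.2.1, Finset.nonempty_iff_ne_empty.2 hS.1, ?_⟩, hS.2.2⟩
    rw [hI _ hS.2.1, inter_eq_right]
    obtain ⟨i, hi⟩ := Finset.nonempty_iff_ne_empty.2 hS.1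
    exact (sInter_subset_of_mem (Finset.mem_coe.2 hi)).trans
      ((subset_sUnion_of_mem (Finset.mem_coe.2 (hS.2.1 hi))).trans hBA)
  have hZm : Measurable Z := Finset.measurable_sum _ fun S _ => (hX _).const_mul _
  have hle : sigmaOf X (borderSets F (⋃₀ (F : Set (Set T)))) ≤
      sigmaOf X {U | U ∩ ((A : Set T) \ ⋃₀ (F : Set (Set T))) = ∅} := by
    refine iSup₂_le fun U hU => le_iSup₂_of_le U ?_ le_rfl
    obtain ⟨⟨S, hSF, ⟨i, hi⟩, hUS⟩, -⟩ := hU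
    rw [mem_ofPred_eq, ← disjoint_iff_inter_eq_empty]
    refine disjoint_sdiff_right.mono_left ?_
    rw [hUS]
    exact (sInter_subset_of_mem (Finset.mem_coe.2 hi)).trans
      (subset_sUnion_of_mem (Finset.mem_coe.2 (hSF hi)))
  rw [strongPast_eq]
  simp_rw [hXA] at hfint ⊢
  exact condExp_comp_add_eq_of_le hle (sigmaOf_le hX _) hY hZm hZ hf hfint

end SetIndexedOU

/-! ### Multiplicative functions on an initial segment -/

/-- A multiplicative function on an initial segment `D` of the nonnegative reals, bounded by `1`,
not identically `1` and tending to `1` along dyadic fractions of each point, is a decaying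
exponential. -/
theorem exists_eq_exp_neg_mul_of_multiplicative {D : Set ℝ} {r : ℝ → ℝ} (hD0 : ∀ t ∈ D, 0 ≤ t)
    (hD : ∀ t ∈ D, ∀ s, 0 ≤ s → s ≤ t → s ∈ D) (hr0 : r 0 = 1) (hr1 : ∀ t ∈ D, r t ≤ 1)
    (hadd : ∀ s t, 0 ≤ s → 0 ≤ t → s + t ∈ D → r (s + t) = r s * r t)
    (hlim : ∀ t ∈ D, Tendsto (fun n : ℕ => r (t / 2 ^ n)) atTop (𝓝 1))
    (hne : ∃ t ∈ D, r t ≠ 1) : ∃ lam : ℝ, 0 < lam ∧ ∀ t ∈ D, r t = Real.exp (-lam * t) := by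
  have hhalf : ∀ t ∈ D, r t = r (t / 2) * r (t / 2) := fun t ht => by
    have h := hD0 t ht
    have := hadd (t / 2) (t / 2) (by positivity) (by positivity) (by rwa [add_halves])
    rwa [add_halves] at this
  have hpos : ∀ t ∈ D, 0 < r t := by
    intro t ht
    refine lt_of_le_of_ne (by rw [hhalf t ht]; exact mul_self_nonneg _) fun h0 => ?_
    -- A zero would propagate by halving to all dyadic fractions of `t`, against the limit `1`.
    have hzero : ∀ n : ℕ, r (t / 2 ^ n) = 0 := by
      intro n
      induction n with
      | zero => simpa using h0.symm
      | succ n ih =>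
        have hmem : t / 2 ^ n ∈ D := hD t ht _ (div_nonneg (hD0 t ht) (by positivity))
          (div_le_self (hD0 t ht) (one_le_pow₀ one_le_two))
        have := hhalf _ hmem
        rw [ih, div_div, ← pow_succ] at this
        exact mul_self_eq_zero.1 this.symm
    have := hlim t ht
    simp only [hzero] at this
    exact zero_ne_one (tendsto_nhds_unique tendsto_const_nhds this)
  let g : ℝ → ℝ := fun t => -Real.log (r t)
  have hg0 : ∀ t ∈ D, 0 ≤ g t := fun t ht =>
    neg_nonneg.2 (Real.log_nonpos (hpos t ht).le (hr1 t ht))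
  have hgadd : ∀ s t, 0 ≤ s → 0 ≤ t → s + t ∈ D → g (s + t) = g s + g t := by
    intro s t hs ht hst
    have h1 := (hpos s (hD _ hst s hs (by linarith))).ne'
    have h2 := (hpos t (hD _ hst t ht (by linarith))).ne'
    simp only [g, hadd s t hs ht hst, Real.log_mul h1 h2]
    ring
  have hgmono : ∀ t ∈ D, ∀ s, 0 ≤ s → s ≤ t → g s ≤ g t := by
    intro t ht s hs hst
    have h1 := hgadd s (t - s) hs (by linarith) (by simpa using ht)
    have h2 := hg0 (t - s) (hD t ht _ (by linarith) (by linarith))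
    rw [add_sub_cancel] at h1
    linarith
  have hgmul : ∀ (n : ℕ) (x : ℝ), 0 ≤ x → n * x ∈ D → g (n * x) = n * g x := by
    intro n x hx
    induction n with
    | zero => intro _; simp [g, hr0]
    | succ n ih =>
      intro hmem
      push_cast at hmem ⊢
      rw [add_mul, one_mul] at hmem ⊢
      rw [hgadd _ _ (by positivity) hx hmem, ih (hD _ hmem _ (by positivity) (by linarith))]
      ring
  -- Comparing `t` with `⌊n t / s⌋` steps of length `s / n` bounds `n (g s * t - g t * s)` by `g s *
  -- s`, which fails for large `n`. Exchanging `s` and `t` gives linearity of `g`.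
  have hcmp : ∀ s ∈ D, ∀ t ∈ D, 0 < s → g s * t ≤ g t * s := by
    intro s hs t ht hs0
    by_contra hlt
    rw [not_le] at hlt
    obtain ⟨n, hn⟩ := exists_nat_gt (g s * s / (g s * t - g t * s))
    have hδ : 0 < g s * t - g t * s := by linarith
    rw [div_lt_iff₀ hδ] at hn
    have hgs := hg0 s hs
    have ht0 := hD0 t ht
    have hn0 : 0 < (n : ℝ) := by
      by_contra h
      have : (n : ℝ) = 0 := le_antisymm (not_lt.1 h) n.cast_nonneg
      rw [this, zero_mul] at hn
      exact absurd hn (not_lt.2 (by positivity))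
    let k := ⌊n * t / s⌋₊
    have hk1 : (k : ℝ) ≤ n * t / s := Nat.floor_le (by positivity)
    have hk2 : n * t / s < k + 1 := Nat.lt_floor_add_one _
    rw [le_div_iff₀ hs0] at hk1
    rw [div_lt_iff₀ hs0] at hk2
    have hkt : k * (s / n) ≤ t := by
      rw [mul_div_assoc', div_le_iff₀ hn0]
      linarith
    have h1 := hgmono t ht _ (by positivity) hkt
    rw [hgmul k _ (by positivity) (hD t ht _ (by positivity) hkt)] at h1
    have hns : (n : ℝ) * (s / n) = s := by field_simp
    have h2 := hgmul n (s / n) (by positivity) (by rwa [hns])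
    rw [hns] at h2
    have h3 : k * g s ≤ n * g t := by
      rw [h2]
      nlinarith
    nlinarith
  obtain ⟨t₁, ht₁, hrt₁⟩ := hne
  have ht₁0 : 0 < t₁ := lt_of_le_of_ne (hD0 _ ht₁) fun h => hrt₁ (h ▸ hr0)
  have hgt₁ : 0 < g t₁ :=
    neg_pos.2 (Real.log_neg (hpos _ ht₁) (lt_of_le_of_ne (hr1 _ ht₁) hrt₁))
  refine ⟨g t₁ / t₁, div_pos hgt₁ ht₁0, fun t ht => ?_⟩
  rcases (hD0 t ht).eq_or_lt with rfl | ht0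
  · simp [hr0]
  · have h := le_antisymm (hcmp _ ht₁ _ ht ht₁0) (hcmp _ ht _ ht₁ ht0)
    rw [neg_mul, div_mul_eq_mul_div, h, mul_div_assoc, div_self ht₁0.ne', mul_one, neg_neg,
      Real.exp_log (hpos t ht)]

/-! ### Second moments of Gaussian processes -/

namespace ProbabilityTheory

variable {ι Ω : Type*} [MeasurableSpace Ω] {P : Measure Ω} {X : ι → Ω → ℝ}

theorem IsGaussianProcess.hasGaussianLaw_comp (hX : IsGaussianProcess X P) {κ : Type*} [Fintype κ]
    (v : κ → ι) : HasGaussianLaw (fun ω i => X (v i) ω) P := by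
  classical
  exact (hX.hasGaussianLaw (Finset.univ.image v)).map
    (ContinuousLinearMap.pi fun i =>
      .proj (⟨v i, Finset.mem_image_of_mem v (Finset.mem_univ i)⟩ : Finset.univ.image v))

theorem IsGaussianProcess.covariance_eq_integral (hX : IsGaussianProcess X P)
    (h0 : ∀ i, ∫ ω, X i ω ∂P = 0) (i j : ι) : cov[X i, X j; P] = ∫ ω, X i ω * X j ω ∂P := by
  have := (hX.hasGaussianLaw_eval i).isProbabilityMeasure
  rw [covariance_eq_sub (hX.hasGaussianLaw_eval i).memLp_two
    (hX.hasGaussianLaw_eval j).memLp_two, h0, zero_mul, sub_zero]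
  rfl

theorem IsGaussianProcess.integrable_mul (hX : IsGaussianProcess X P) (i j : ι) :
    Integrable (fun ω => X i ω * X j ω) P :=
  (hX.hasGaussianLaw_eval i).memLp_two.integrable_mul (hX.hasGaussianLaw_eval j).memLp_two

theorem IsGaussianProcess.integral_sq_sub (hX : IsGaussianProcess X P) (i j : ι) :
    ∫ ω, |X i ω - X j ω| ^ 2 ∂P =
      ∫ ω, X i ω * X i ω ∂P + ∫ ω, X j ω * X j ω ∂P - 2 * ∫ ω, X i ω * X j ω ∂P := by
  have hfun : (fun ω => |X i ω - X j ω| ^ 2) =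
      fun ω => X i ω * X i ω + X j ω * X j ω - 2 * (X i ω * X j ω) := by
    ext ω
    rw [sq_abs]
    ring
  have hadd := (hX.integrable_mul i i).add (hX.integrable_mul j j)
  simp only [Pi.add_def] at hadd
  rw [hfun, integral_sub hadd ((hX.integrable_mul i j).const_mul 2),
    integral_add (hX.integrable_mul i i)
    (hX.integrable_mul j j), integral_const_mul]

end ProbabilityTheory

/-! ### Continuity and stationarity from the covariance -/

namespace SetIndexedOU

variable {T : Type*} [MetricSpace T] {𝒜 : Set (Set T)} [MeasurableSpace T] {m : Measure T}
  {Ω : Type*} [MeasurableSpace Ω] {P : Measure Ω} {X : 𝒜 → Ω → ℝ}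

/-- For nested sets the squared distance is `2K (1 - exp (-λ |m U - m W|))`, so both continuities
reduce to convergence of measures. -/
theorem isL2MonotoneContinuous_of_covariance (hm : IsIndexingMeasure 𝒜 m)
    (hG : IsGaussianProcess X P) {K lam : ℝ}
    (hcov : ∀ U V : 𝒜, ∫ ω, X U ω * X V ω ∂P =
      K * Real.exp (-lam * m.real (symmDiff (U : Set T) (V : Set T)))) :
    IsL2MonotoneContinuous X P := by
  have key : ∀ (U : ℕ → 𝒜) (W : 𝒜), (∀ n, (U n : Set T) ⊆ W ∨ (W : Set T) ⊆ U n) →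
      Tendsto (fun n => m (U n : Set T)) atTop (𝓝 (m (W : Set T))) →
      Tendsto (fun n => ∫ ω, |X (U n) ω - X W ω| ^ 2 ∂P) atTop (𝓝 0) := by
    intro U W hUW hlim
    have hreal : Tendsto (fun n => m.real (U n : Set T)) atTop (𝓝 (m.real (W : Set T))) :=
      (ENNReal.tendsto_toReal (hm.lt_top _ W.2).ne).comp hlim
    have hdist : ∀ n, m.real (symmDiff (U n : Set T) (W : Set T)) =
        |m.real (U n : Set T) - m.real (W : Set T)| := by
      intro n
      rw [hm.real_symmDiff (U n).2 W.2]
      rcases hUW n with h | h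
      · rw [inter_eq_left.2 h,
          abs_of_nonpos (sub_nonpos.2 (measureReal_mono h (hm.lt_top _ W.2).ne))]
        ring
      · rw [inter_eq_right.2 h,
          abs_of_nonneg (sub_nonneg.2 (measureReal_mono h (hm.lt_top _ (U n).2).ne))]
        ring
    simp_rw [hG.integral_sq_sub, hcov, hdist, symmDiff_self, bot_eq_empty, measureReal_empty]
    have hcont : Continuous fun x : ℝ => K * Real.exp (-lam * 0) + K * Real.exp (-lam * 0) -
        2 * (K * Real.exp (-lam * |x - m.real (W : Set T)|)) := by fun_prop
    have := (hcont.tendsto (m.real (W : Set T))).comp hreal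
    refine this.congr' (Eventually.of_forall fun n => rfl) |>.trans_eq ?_
    simp
    ring
  refine ⟨fun U W hU hW => key U W (fun n => Or.inl ?_) ?_,
    fun V W hV hW => key V W (fun n => Or.inr ?_) ?_⟩
  · rw [hW]
    exact (subset_iUnion (fun n => (U n : Set T)) n).trans subset_closure
  · have hmem : closure (⋃ n, (U n : Set T)) ∈ 𝒜 := hW ▸ W.2
    rw [hW]
    exact hm.tendsto_closure _ (fun n => (U n).2) hU hmem
  · rw [hW]
    exact iInter_subset _ n
  · rw [hW]
    exact tendsto_measure_iInter_atTop
      (fun n => (hm.measurableSet _ (V n).2).nullMeasurableSet) hV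
      ⟨0, (hm.lt_top _ (V 0).2).ne⟩

/-- The measures of the `U i` exceed those of the `A i` by the common amount `m V`, and along a
chain covariances involve only differences of measures. -/
theorem isMStationary_of_covariance (hm : IsIndexingMeasure 𝒜 m)
    (hG : IsGaussianProcess X P) (h0 : ∀ U, ∫ ω, X U ω ∂P = 0) {K lam : ℝ}
    (hcov : ∀ U V : 𝒜, cov[X U, X V; P] =
      K * Real.exp (-lam * m.real (symmDiff (U : Set T) (V : Set T)))) :
    IsMStationary X m P := by
  intro k V U A hU hA hVU hmeas
  have hreal : ∀ i, m.real (U i : Set T) = m.real (V : Set T) + m.real (A i : Set T) := by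
    intro i
    have h1 := measureReal_inter_add_sdiff (μ := m) (hm.measurableSet _ V.2)
      (hm.lt_top _ (U i).2).ne
    rw [inter_eq_right.2 (hVU i)] at h1
    rw [← h1, Measure.real, Measure.real, Measure.real, hmeas]
  refine HasGaussianLaw.identDistrib_of_covariance_eq (hG.hasGaussianLaw_comp U)
    (hG.hasGaussianLaw_comp A) (fun i => by rw [h0, h0]) fun i j => ?_
  rw [hcov, hcov, hm.real_symmDiff (U i).2 (U j).2, hm.real_symmDiff (A i).2 (A j).2]
  rcases le_total i j with hij | hij
  · rw [inter_eq_left.2 (show (U i : Set T) ⊆ U j from hU hij),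
      inter_eq_left.2 (show (A i : Set T) ⊆ A j from hA hij), hreal i, hreal j]
    ring_nf
  · rw [inter_eq_right.2 (show (U j : Set T) ⊆ U i from hU hij),
      inter_eq_right.2 (show (A j : Set T) ⊆ A i from hA hij), hreal i, hreal j]
    ring_nf

end SetIndexedOU

/-! ### Factorization of covariances at a single member -/

namespace SetIndexedOU

variable {T : Type*} [MetricSpace T] {𝒜 : Set (Set T)}

/-- A `B` contained in its own interior would be relatively open in `A`, which the absence of gaps
excludes. Thus `X B` is measurable for the border σ-algebra. -/
theorem IsIndexingCollection.mem_borderSets_singleton (h : IsIndexingCollection 𝒜) {A B : Set T}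
    (hA : A ∈ 𝒜) (hB : B ∈ 𝒜) (hBA : B ⊂ A) : B ∈ borderSets {B} B := by
  refine ⟨⟨{B}, subset_rfl, by simp, by simp⟩, fun hsub => ?_⟩
  exact hBA.ne (h.eq_of_inter_subset_interior hB hA hBA.subset inter_subset_right hsub)

theorem eq_of_mem_borderSets_singleton {B U : Set T} (hU : U ∈ borderSets {B} B) : U = B := by
  obtain ⟨⟨G, hG, hne, rfl⟩, -⟩ := hU
  rcases Finset.subset_singleton_iff.1 hG with rfl | rfl
  · exact absurd hne Finset.not_nonempty_empty
  · simp

section Measure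

variable [MeasurableSpace T] {m : Measure T}

theorem IsIndexingCollection.exists_measureReal_eq (h : IsIndexingCollection 𝒜)
    (hm : IsIndexingMeasure 𝒜 m) {U V : 𝒜} (hUV : (U : Set T) ⊆ V) {t : ℝ}
    (hUt : m.real (U : Set T) ≤ t) (htV : t ≤ m.real (V : Set T)) :
    ∃ W : 𝒜, (U : Set T) ⊆ W ∧ (W : Set T) ⊆ V ∧ m.real (W : Set T) = t := by
  have hV := (hm.lt_top _ V.2).ne
  have ht : 0 ≤ t := measureReal_nonneg.trans hUt
  obtain ⟨W, hW, h1, h2, h3⟩ := h.exists_measure_eq hm U.2 V.2 hUV (t := ENNReal.ofReal t)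
    ((ENNReal.le_ofReal_iff_toReal_le (hm.lt_top _ U.2).ne ht).2 hUt)
    ((ENNReal.ofReal_le_iff_le_toReal hV).2 htV)
  exact ⟨⟨W, hW⟩, h1, h2, by rw [Measure.real, h3, ENNReal.toReal_ofReal ht]⟩

end Measure

variable {Ω : Type*} [MeasurableSpace Ω] {P : Measure Ω} {X : 𝒜 → Ω → ℝ}

/-- Covariance form of the Markov property at a single member `B` of `𝒜`. -/
theorem IsCMarkov.integral_mul [IsProbabilityMeasure P] (hmk : IsCMarkov X P)
    (h : IsIndexingCollection 𝒜) (hX : ∀ U, Measurable (X U)) (hG : IsGaussianProcess X P)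
    (h0 : ∀ U, ∫ ω, X U ω ∂P = 0) {U A B : 𝒜} (hBA : (B : Set T) ⊆ A)
    (hUA : (U : Set T) ∩ A ⊆ B) (hB0 : ∫ ω, X B ω * X B ω ∂P ≠ 0) :
    (∫ ω, X U ω * X A ω ∂P) * ∫ ω, X B ω * X B ω ∂P =
      (∫ ω, X B ω * X A ω ∂P) * ∫ ω, X U ω * X B ω ∂P := by
  by_cases heq : B = A
  · rw [heq, mul_comm]
  have hss : (B : Set T) ⊂ A := hBA.ssubset_of_ne fun he => heq (Subtype.ext he)
  have hL2 : ∀ U, MemLp (X U) 2 P := fun U => (hG.hasGaussianLaw_eval U).memLp_two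
  have hint : ∀ U, Integrable (X U) P := fun U => (hG.hasGaussianLaw_eval U).integrable
  let F : Finset (Set T) := {(B : Set T)}
  have h_border : (sigmaOf X (borderSets F (B : Set T))) ≤ ‹MeasurableSpace Ω› := sigmaOf_le hX _
  have h_past : (strongPast X ((A : Set T) \ B)) ≤ ‹MeasurableSpace Ω› :=
    (strongPast_eq X _).trans_le (sigmaOf_le hX _)
  have hmarkov : ∀ f : ℝ → ℝ, Measurable f → (∀ x, 0 ≤ f x) →
      Integrable (fun ω => f (X A ω)) P →
      P[fun ω => f (X A ω) | strongPast X ((A : Set T) \ B)] =ᵐ[P]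
        P[fun ω => f (X A ω) | sigmaOf X (borderSets F (B : Set T))] :=
    hmk A B ⟨F, by simp [F], by simp [F]⟩ hBA (nonempty_of_ssubset hss) F
      ⟨by simp [F], by simp [F], by simp [F]⟩
  have hcond : P[X A | strongPast X ((A : Set T) \ B)] =ᵐ[P]
      P[X A | sigmaOf X (borderSets F (B : Set T))] := by
    -- The Markov property only covers nonnegative functions, so `X A` is split into positive and
    -- negative parts.
    have hpos := hmarkov (fun x => max x 0) (by fun_prop) (fun x => le_max_right _ _)
      (hint A).pos_part
    have hneg := hmarkov (fun x => max (-x) 0) (by fun_prop) (fun x => le_max_right _ _)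
      (hint A).neg_part
    have hdecomp : X A = (fun ω => max (X A ω) 0) - fun ω => max (-X A ω) 0 := by
      ext ω
      exact (max_zero_sub_max_neg_zero_eq_self _).symm
    rw [hdecomp]
    filter_upwards [hpos, hneg, condExp_sub (hint A).pos_part (hint A).neg_part
        (strongPast X ((A : Set T) \ B)),
      condExp_sub (hint A).pos_part (hint A).neg_part (sigmaOf X (borderSets F (B : Set T)))]
      with ω h1 h2 h3 h4
    rw [h3, h4, Pi.sub_apply, Pi.sub_apply, h1, h2]
  -- The regression coefficient, making `X A - a * X B` uncorrelated with `X B`.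
  let a : ℝ := (∫ ω, X B ω * X A ω ∂P) / ∫ ω, X B ω * X B ω ∂P
  have ha : a * ∫ ω, X B ω * X B ω ∂P = ∫ ω, X B ω * X A ω ∂P := div_mul_cancel₀ _ hB0
  let v : Fin 2 → 𝒜 := ![A, B]
  let c : Fin 2 → ℝ := ![1, -a]
  have hind : Indep (sigmaOf X (borderSets F (B : Set T))) (MeasurableSpace.comap
      (fun ω => ∑ j ∈ Finset.univ, c j * X (v j) ω) inferInstance) P := by
    refine hG.indep_linearCombination hX (S := {U : 𝒜 | (U : Set T) ∈ borderSets F B})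
      Finset.univ v c fun V hV => ?_
    obtain rfl : V = B := Subtype.ext (eq_of_mem_borderSets_singleton hV)
    rw [covariance_fun_sum_right' (fun j _ => (hL2 _).const_mul _) (hL2 _)]
    simp only [Fin.sum_univ_two, covariance_const_mul_right, hG.covariance_eq_integral h0, c, v,
      Matrix.cons_val_zero, Matrix.cons_val_one]
    rw [neg_mul, ha]
    ring
  let Z : Ω → ℝ := fun ω => X A ω - a * X B ω
  have hZ : (fun ω => ∑ j ∈ Finset.univ, c j * X (v j) ω) = Z := by
    ext ω
    simp only [Fin.sum_univ_two, c, v, Z, Matrix.cons_val_zero, Matrix.cons_val_one]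
    ring
  rw [hZ] at hind
  have hZm : Measurable Z := (hX A).sub ((hX B).const_mul a)
  have hZint : Integrable Z P := (hint A).sub ((hint B).const_mul a)
  have hZ0 : ∫ ω, Z ω ∂P = 0 := by
    rw [integral_sub (hint A) ((hint B).const_mul a), integral_const_mul, h0, h0]
    simp
  have hcondZ : P[Z | sigmaOf X (borderSets F (B : Set T))] =ᵐ[P] fun _ => ∫ ω, Z ω ∂P :=
    condExp_indep_eq hZm.comap_le h_border (comap_measurable Z).stronglyMeasurable hind.symm
  have hBm : Measurable[sigmaOf X (borderSets F (B : Set T))] fun ω => a * X B ω :=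
    (measurable_sigmaOf X (h.mem_borderSets_singleton A.2 B.2 hss)).const_mul a
  have hcondA : P[X A | sigmaOf X (borderSets F (B : Set T))] =ᵐ[P] fun ω => a * X B ω := by
    have hsplit : X A = (fun ω => a * X B ω) + Z := by
      ext ω
      simp [Z]
    rw [hsplit]
    filter_upwards [condExp_add ((hint B).const_mul a) hZint (sigmaOf X (borderSets F (B : Set T))), hcondZ]
      with ω h1 h2
    rw [h1, Pi.add_apply, h2, hZ0, add_zero,
      condExp_of_stronglyMeasurable h_border hBm.stronglyMeasurable ((hint B).const_mul a)]
  have hUm : StronglyMeasurable[strongPast X ((A : Set T) \ B)] (X U) := by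
    have hmem : (U : Set T) ∈ {V : Set T | V ∩ ((A : Set T) \ B) = ∅} := by
      refine subset_empty_iff.1 fun x hx => ?_
      exact hx.2.2 (hUA ⟨hx.1, hx.2.1⟩)
    have := measurable_sigmaOf X hmem
    rw [← strongPast_eq] at this
    exact this.stronglyMeasurable
  have hmain : ∫ ω, X U ω * X A ω ∂P = a * ∫ ω, X U ω * X B ω ∂P := by
    have hpull : P[X U * X A | strongPast X ((A : Set T) \ B)] =ᵐ[P]
        X U * P[X A | strongPast X ((A : Set T) \ B)] :=
      condExp_mul_of_stronglyMeasurable_left hUm (hG.integrable_mul U A) (hint A)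
    rw [← integral_condExp h_past (f := fun ω => X U ω * X A ω), ← integral_const_mul]
    refine integral_congr_ae ?_
    filter_upwards [hpull, hcond, hcondA] with ω h1 h2 h3
    refine h1.trans ?_
    rw [Pi.mul_apply, h2, h3]
    ring
  rw [hmain, ← ha]
  ring

end SetIndexedOU

/-! ### The covariance function and the converse -/

namespace SetIndexedOU

variable {T : Type*} {𝒜 : Set (Set T)} [MeasurableSpace T] {m : Measure T}
  {Ω : Type*} [MeasurableSpace Ω] {P : Measure Ω} {X : 𝒜 → Ω → ℝ}

theorem IsMStationary.integral_mul_eq (hst : IsMStationary X m P) {V U₁ U₂ A₁ A₂ : 𝒜}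
    (hVU : (V : Set T) ⊆ U₁) (hU : (U₁ : Set T) ⊆ U₂) (hA : (A₁ : Set T) ⊆ A₂)
    (h₁ : m ((U₁ : Set T) \ V) = m (A₁ : Set T)) (h₂ : m ((U₂ : Set T) \ V) = m (A₂ : Set T)) :
    ∫ ω, X U₁ ω * X U₂ ω ∂P = ∫ ω, X A₁ ω * X A₂ ω ∂P := by
  have hmono : ∀ {B₁ B₂ : 𝒜}, (B₁ : Set T) ⊆ B₂ → Monotone ![B₁, B₂] := by
    intro B₁ B₂ hB i j hij
    fin_cases i <;> fin_cases j
    · exact le_rfl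
    · exact hB
    · exact absurd hij (by decide)
    · exact le_rfl
  have hid := hst 2 V ![U₁, U₂] ![A₁, A₂] (hmono hU) (hmono hA)
    (fun i => by
      fin_cases i
      · exact hVU
      · exact hVU.trans hU)
    (fun i => by
      fin_cases i
      · exact h₁
      · exact h₂)
  have hmeas : Measurable fun x : Fin 2 → ℝ => x 0 * x 1 := by fun_prop
  exact (hid.comp hmeas).integral_eq

variable [MetricSpace T]

/-- The covariance of a stationary process along nested members is a function of the measure of
the difference. -/
theorem IsMStationary.exists_covarianceFunction (hst : IsMStationary X m P)
    (h : IsIndexingCollection 𝒜) (hm : IsIndexingMeasure 𝒜 m) :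
    ∃ ρ : ℝ → ℝ, ∀ U V : 𝒜, (U : Set T) ⊆ V →
      ∫ ω, X U ω * X V ω ∂P = ρ (m.real (V : Set T) - m.real (U : Set T)) := by
  let E : 𝒜 := ⟨⋂₀ 𝒜, h.sInter_self_mem⟩
  have hE : ∀ A : 𝒜, (E : Set T) ⊆ A := fun A => sInter_subset_of_mem A.2
  have hE0 : m (E : Set T) = 0 := hm.sInter_eq_zero
  have hEr : m.real (E : Set T) = 0 := by rw [Measure.real, hE0, ENNReal.toReal_zero]
  have hwell : ∀ A B : 𝒜, m.real (A : Set T) = m.real (B : Set T) →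
      ∫ ω, X E ω * X A ω ∂P = ∫ ω, X E ω * X B ω ∂P := by
    intro A B hAB
    refine hst.integral_mul_eq (V := E) subset_rfl (hE A) (hE B) (by simp [hE0]) ?_
    rw [measure_sdiff_null hE0]
    exact (ENNReal.toReal_eq_toReal_iff' (hm.lt_top _ A.2).ne (hm.lt_top _ B.2).ne).1 hAB
  classical
  -- Covariances are read off against `∅'`; the value `0` at unattained measures is a dummy.
  let ρ : ℝ → ℝ := fun t =>
    if ht : ∃ A : 𝒜, m.real (A : Set T) = t then ∫ ω, X E ω * X ht.choose ω ∂P else 0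
  refine ⟨ρ, fun U V hUV => ?_⟩
  have hsub := measureReal_sdiff_add_inter (μ := m) (s := (V : Set T)) (hm.measurableSet _ U.2)
    (hm.lt_top _ V.2).ne
  rw [inter_eq_right.2 hUV] at hsub
  obtain ⟨A, -, -, hA⟩ := h.exists_measureReal_eq hm (hE V)
    (t := m.real (V : Set T) - m.real (U : Set T))
    (by rw [hEr]; linarith [measureReal_nonneg (μ := m) (s := (V : Set T) \ U)])
    (by linarith [measureReal_nonneg (μ := m) (s := (U : Set T))])
  have hex : ∃ A : 𝒜, m.real (A : Set T) = m.real (V : Set T) - m.real (U : Set T) := ⟨A, hA⟩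
  simp only [ρ, dif_pos hex]
  -- Removing `U` from the pair `(U, V)` leaves measures `0` and `m V - m U`, those of `∅'` and the
  -- chosen member.
  refine hst.integral_mul_eq (V := U) subset_rfl hUV (hE _) (by simp [hE0]) ?_
  refine (ENNReal.toReal_eq_toReal_iff'
    (measure_ne_top_of_subset sdiff_subset (hm.lt_top _ V.2).ne)
    (hm.lt_top _ (Subtype.prop _)).ne).1 ?_
  have := hex.choose_spec
  rw [Measure.real] at this
  rw [this, ← hsub, add_sub_cancel_right]
  rfl

/-- Repeated halving of measures gives a decreasing sequence in `𝒜` whose intersection is null;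
outer continuity along it is exactly this limit. -/
theorem IsL2MonotoneContinuous.tendsto_covarianceFunction (hc : IsL2MonotoneContinuous X P)
    (h : IsIndexingCollection 𝒜) (hm : IsIndexingMeasure 𝒜 m) (hG : IsGaussianProcess X P)
    {ρ : ℝ → ℝ} (hρ : ∀ U V : 𝒜, (U : Set T) ⊆ V →
      ∫ ω, X U ω * X V ω ∂P = ρ (m.real (V : Set T) - m.real (U : Set T))) (A : 𝒜) :
    Tendsto (fun n : ℕ => ρ (m.real (A : Set T) / 2 ^ n)) atTop (𝓝 (ρ 0)) := by
  let E : 𝒜 := ⟨⋂₀ 𝒜, h.sInter_self_mem⟩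
  have hE : ∀ A : 𝒜, (E : Set T) ⊆ A := fun A => sInter_subset_of_mem A.2
  have hEr : m.real (E : Set T) = 0 := by
    rw [Measure.real, hm.sInter_eq_zero, ENNReal.toReal_zero]
  have hnext : ∀ B : 𝒜, ∃ W : 𝒜, (W : Set T) ⊆ B ∧ m.real (W : Set T) = m.real (B : Set T) / 2 := by
    intro B
    have hB := measureReal_nonneg (μ := m) (s := (B : Set T))
    obtain ⟨W, -, h1, h2⟩ := h.exists_measureReal_eq hm (hE B) (t := m.real (B : Set T) / 2)
      (by rw [hEr]; linarith) (by linarith)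
    exact ⟨W, h1, h2⟩
  choose next hnext1 hnext2 using hnext
  let W : ℕ → 𝒜 := fun n => Nat.rec (motive := fun _ => 𝒜) A (fun _ B => next B) n
  have hW : ∀ n, m.real (W n : Set T) = m.real (A : Set T) / 2 ^ n := by
    intro n
    induction n with
    | zero => simp [W]
    | succ n ih =>
      change m.real (next (W n) : Set T) = _
      rw [hnext2, ih, div_div, pow_succ]
  have hanti : Antitone W := antitone_nat_of_succ_le fun n => hnext1 (W n)
  let L : 𝒜 := ⟨⋂ n, (W n : Set T), by
    rw [← sInter_range]
    exact h.sInter_mem _ (by rintro _ ⟨n, rfl⟩; exact (W n).2) (range_nonempty _)⟩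
  have hLW : ∀ n, (L : Set T) ⊆ W n := fun n => iInter_subset _ n
  have hhalf : Tendsto (fun n : ℕ => m.real (A : Set T) / 2 ^ n) atTop (𝓝 0) := by
    simp_rw [div_eq_mul_inv, ← inv_pow]
    simpa using (tendsto_pow_atTop_nhds_zero_of_lt_one (r := (2 : ℝ)⁻¹) (by norm_num)
      (by norm_num)).const_mul (m.real (A : Set T))
  have hL0 : m.real (L : Set T) = 0 :=
    le_antisymm (ge_of_tendsto' hhalf fun n => by
      rw [← hW]
      exact measureReal_mono (hLW n) (hm.lt_top _ (W n).2).ne) measureReal_nonneg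
  have hlim := hc.2 W L hanti rfl
  have hterm : ∀ n, ρ (m.real (A : Set T) / 2 ^ n) =
      ρ 0 - (∫ ω, |X (W n) ω - X L ω| ^ 2 ∂P) / 2 := by
    intro n
    have hcomm : ∫ ω, X (W n) ω * X L ω ∂P = ∫ ω, X L ω * X (W n) ω ∂P := by
      simp_rw [mul_comm]
    rw [hG.integral_sq_sub, hcomm, hρ _ _ (subset_rfl : (W n : Set T) ⊆ W n),
      hρ _ _ (subset_rfl : (L : Set T) ⊆ L), hρ _ _ (hLW n), hL0, hW]
    simp
    ring
  simp_rw [hterm]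
  simpa using (hlim.div_const 2).const_sub (ρ 0)

theorem isStationarySetIndexedOU_of_markov [IsProbabilityMeasure P]
    (h : IsIndexingCollection 𝒜) (hm : IsIndexingMeasure 𝒜 m) (hX : ∀ U, Measurable (X U))
    (hG : IsGaussianProcess X P) (h0 : ∀ U, ∫ ω, X U ω ∂P = 0) (hne : ∃ U, ¬ X U =ᵐ[P] 0)
    (hnc : (∃ U ∈ 𝒜, m U ≠ 0) → ∃ U V, ¬ X U =ᵐ[P] X V) (hc : IsL2MonotoneContinuous X P)
    (hst : IsMStationary X m P) (hmk : IsCMarkov X P) : IsStationarySetIndexedOU X m P := by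
  refine ⟨hG, h0, ?_⟩
  obtain ⟨ρ, hρ⟩ := hst.exists_covarianceFunction h hm
  let E : 𝒜 := ⟨⋂₀ 𝒜, h.sInter_self_mem⟩
  have hE : ∀ A : 𝒜, (E : Set T) ⊆ A := fun A => sInter_subset_of_mem A.2
  have hEr : m.real (E : Set T) = 0 := by
    rw [Measure.real, hm.sInter_eq_zero, ENNReal.toReal_zero]
  have hself : ∀ U : 𝒜, ∫ ω, X U ω * X U ω ∂P = ρ 0 := fun U => by
    rw [hρ U U subset_rfl, sub_self]
  have hcomm : ∀ U V : 𝒜, ∫ ω, X U ω * X V ω ∂P = ∫ ω, X V ω * X U ω ∂P := fun U V => by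
    simp_rw [mul_comm]
  have hpos : 0 < ρ 0 := by
    obtain ⟨U, hU⟩ := hne
    refine lt_of_le_of_ne (hself U ▸ integral_nonneg fun ω => mul_self_nonneg _) fun hz => hU ?_
    have := (integral_eq_zero_iff_of_nonneg (fun ω => mul_self_nonneg (X U ω))
      (hG.integrable_mul U U)).1 ((hself U).trans hz.symm)
    filter_upwards [this] with ω hω
    exact mul_self_eq_zero.1 hω
  have hmarkov : ∀ U A B : 𝒜, (B : Set T) ⊆ A → (U : Set T) ∩ A ⊆ B →
      (∫ ω, X U ω * X A ω ∂P) * ρ 0 =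
        (∫ ω, X B ω * X A ω ∂P) * ∫ ω, X U ω * X B ω ∂P := by
    intro U A B hBA hUA
    have := hmk.integral_mul h hX hG h0 hBA hUA (by rw [hself]; exact hpos.ne')
    rwa [hself] at this
  have hgen : ∀ U V : 𝒜, (∫ ω, X U ω * X V ω ∂P) * ρ 0 =
      ρ (m.real (V : Set T) - m.real ((U : Set T) ∩ V)) *
        ρ (m.real (U : Set T) - m.real ((U : Set T) ∩ V)) := by
    intro U V
    let B : 𝒜 := ⟨(U : Set T) ∩ V, h.inter_mem U.2 V.2⟩
    rw [hmarkov U V B inter_subset_right subset_rfl, hcomm U B,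
      hρ B V inter_subset_right, hρ B U inter_subset_left]
  have hsq : ∀ U V : 𝒜, ∫ ω, |X U ω - X V ω| ^ 2 ∂P = 2 * ρ 0 - 2 * ∫ ω, X U ω * X V ω ∂P := by
    intro U V
    rw [hG.integral_sq_sub, hself, hself]
    ring
  let D : Set ℝ := range fun A : 𝒜 => m.real (A : Set T)
  have hρE : ∀ A : 𝒜, ∫ ω, X E ω * X A ω ∂P = ρ (m.real (A : Set T)) := fun A => by
    rw [hρ E A (hE A), hEr, sub_zero]
  have hexp : ∃ lam : ℝ, 0 < lam ∧ ∀ t ∈ D, ρ t = ρ 0 * Real.exp (-lam * t) := by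
    -- If `ρ` is constant on `D`, all the `X U` agree a.s., so non-degeneracy forces `m` to vanish
    -- on `𝒜` and any rate works.
    by_cases hall : ∀ t ∈ D, ρ t = ρ 0
    · by_cases hm0 : ∃ U ∈ 𝒜, m U ≠ 0
      · obtain ⟨U, V, hUV⟩ := hnc hm0
        refine absurd ?_ hUV
        have hD : ∀ A B : 𝒜, (B : Set T) ⊆ A → ρ (m.real (A : Set T) - m.real (B : Set T)) = ρ 0 := by
          intro A B hBA
          have hmono := measureReal_mono (μ := m) hBA (hm.lt_top _ A.2).ne
          obtain ⟨W, -, -, hW⟩ := h.exists_measureReal_eq hm (hE A)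
            (t := m.real (A : Set T) - m.real (B : Set T)) (by rw [hEr]; linarith)
            (by linarith [measureReal_nonneg (μ := m) (s := (B : Set T))])
          exact hall _ ⟨W, hW⟩
        have hUVB := hgen U V
        rw [hD V ⟨_, h.inter_mem U.2 V.2⟩ inter_subset_right,
          hD U ⟨_, h.inter_mem U.2 V.2⟩ inter_subset_left] at hUVB
        have hz : ∫ ω, |X U ω - X V ω| ^ 2 ∂P = 0 := by
          rw [hsq, mul_right_cancel₀ hpos.ne' hUVB, sub_self]
        have hL2 : MemLp (fun ω => X U ω - X V ω) 2 P :=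
          (hG.hasGaussianLaw_eval U).memLp_two.sub (hG.hasGaussianLaw_eval V).memLp_two
        have hint : Integrable (fun ω => |X U ω - X V ω| ^ 2) P := by
          simpa only [sq_abs] using hL2.integrable_sq
        have := (integral_eq_zero_iff_of_nonneg (fun ω => by positivity) hint).1 hz
        filter_upwards [this] with ω hω
        simpa [sub_eq_zero] using hω
      · push Not at hm0
        refine ⟨1, one_pos, ?_⟩
        rintro _ ⟨A, rfl⟩
        simp [Measure.real, hm0 _ A.2]
    · push Not at hall
      obtain ⟨t₁, ht₁, hne₁⟩ := hall
      suffices hr : ∃ lam : ℝ, 0 < lam ∧ ∀ t ∈ D, ρ t / ρ 0 = Real.exp (-lam * t) by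
        obtain ⟨lam, hlam, hr⟩ := hr
        refine ⟨lam, hlam, fun t ht => ?_⟩
        rw [← hr t ht, mul_div_cancel₀ _ hpos.ne']
      refine exists_eq_exp_neg_mul_of_multiplicative (r := fun t => ρ t / ρ 0) ?_ ?_
        (div_self hpos.ne') ?_ ?_ ?_ ⟨t₁, ht₁, by rwa [Ne, div_eq_one_iff_eq hpos.ne']⟩
      · rintro _ ⟨A, rfl⟩
        exact measureReal_nonneg
      · rintro _ ⟨A, rfl⟩ s hs hsA
        obtain ⟨W, -, -, hW⟩ := h.exists_measureReal_eq hm (hE A) (by rwa [hEr]) hsA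
        exact ⟨W, hW⟩
      · rintro _ ⟨A, rfl⟩
        rw [div_le_one hpos, ← hρE A]
        have := hsq E A
        have h1 : 0 ≤ ∫ ω, |X E ω - X A ω| ^ 2 ∂P := integral_nonneg fun ω => by positivity
        linarith
      · rintro s t hs ht ⟨A, hA⟩
        have hA' : m.real (A : Set T) = s + t := hA
        obtain ⟨B, -, hBA, hB⟩ := h.exists_measureReal_eq hm (hE A) (t := s) (by rwa [hEr])
          (by rw [hA']; linarith)
        -- Splitting at `B` of measure `s` inside `A` of measure `s + t` gives `ρ (s + t) * ρ 0 = ρ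
        -- t * ρ s`.
        have := hmarkov E A B hBA (inter_subset_left.trans (hE B))
        rw [hρE, hρE, hρ B A hBA, hB, hA', add_sub_cancel_left] at this
        field_simp
        linarith
      · rintro _ ⟨A, rfl⟩
        have := (hc.tendsto_covarianceFunction h hm hG hρ A).div_const (ρ 0)
        rwa [div_self hpos.ne'] at this
  obtain ⟨lam, hlam, hexp⟩ := hexp
  -- `σ` is fixed by matching the variance: `σ ^ 2 / (2 * lam) = ρ 0`.
  refine ⟨lam, Real.sqrt (2 * lam * ρ 0), hlam, Real.sqrt_pos.2 (by positivity), fun U V => ?_⟩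
  have hnest : ∀ A B : 𝒜, (B : Set T) ⊆ A → ρ (m.real (A : Set T) - m.real (B : Set T)) =
      ρ 0 * Real.exp (-lam * (m.real (A : Set T) - m.real (B : Set T))) := by
    intro A B hBA
    have hmono := measureReal_mono (μ := m) hBA (hm.lt_top _ A.2).ne
    obtain ⟨W, -, -, hW⟩ := h.exists_measureReal_eq hm (hE A)
      (t := m.real (A : Set T) - m.real (B : Set T)) (by rw [hEr]; linarith)
      (by linarith [measureReal_nonneg (μ := m) (s := (B : Set T))])
    exact hexp _ ⟨W, hW⟩
  have hUVB := hgen U V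
  rw [hnest V ⟨_, h.inter_mem U.2 V.2⟩ inter_subset_right,
    hnest U ⟨_, h.inter_mem U.2 V.2⟩ inter_subset_left] at hUVB
  refine mul_right_cancel₀ hpos.ne' (hUVB.trans ?_)
  rw [Real.sq_sqrt (by positivity), mul_div_cancel_left₀ _ (by positivity), mul_mul_mul_comm,
    ← Real.exp_add, hm.real_symmDiff U.2 V.2]
  ring_nf

end SetIndexedOU

theorem mainTheorem1 {T : Type*} [MetricSpace T] [LocallyCompactSpace T] [MeasurableSpace T]
    (𝒜 : Set (Set T)) (h𝒜 : SetIndexedOU.IsIndexingCollection 𝒜)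
    (m : Measure T) (hm : SetIndexedOU.IsIndexingMeasure 𝒜 m)
    {Ω : Type*} [MeasurableSpace Ω] (P : Measure Ω) [IsProbabilityMeasure P]
    (X : 𝒜 → Ω → ℝ) (hX : ∀ U, Measurable (X U))
    (hGauss : IsGaussianProcess X P) (hmean : ∀ U, ∫ ω, X U ω ∂P = 0)
    (hne : ∃ U, ¬ X U =ᵐ[P] 0)
    (hnc : (∃ U ∈ 𝒜, m U ≠ 0) → ∃ U V, ¬ X U =ᵐ[P] X V) :
    SetIndexedOU.IsStationarySetIndexedOU X m P ↔
      SetIndexedOU.IsL2MonotoneContinuous X P ∧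
      SetIndexedOU.IsMStationary X m P ∧
      SetIndexedOU.IsCMarkov X P := by
  constructor
  · rintro ⟨-, -, lam, σ, -, -, hint⟩
    have hcov : ∀ U V : 𝒜, cov[X U, X V; P] = σ ^ 2 / (2 * lam) *
        Real.exp (-lam * m.real (symmDiff (U : Set T) (V : Set T))) := fun U V => by
      rw [hGauss.covariance_eq_integral hmean, hint]
    exact ⟨SetIndexedOU.isL2MonotoneContinuous_of_covariance hm hGauss hint,
      SetIndexedOU.isMStationary_of_covariance hm hGauss hmean hcov,
      SetIndexedOU.isCMarkov_of_covariance h𝒜 hm hX hGauss hcov⟩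
  · rintro ⟨hc, hst, hmk⟩
    exact SetIndexedOU.isStationarySetIndexedOU_of_markov h𝒜 hm hX hGauss hmean hne hnc hc hst hmk
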